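/- A pushdown automaton (PDA) is a tuple $P=(Q,\Sigma,\Gamma,\delta,q_0,Z_0,F)$ with finite sets $Q$ of states, $\Sigma$ of input letters and $\Gamma$ of stack symbols, a transition function $\delta: Q\times(\Sigma\cup\{\varepsilon\})\times\Gamma\to 2^{Q\times\Gamma^{\le 2}}$, an initial state $q_0\in Q$, an initial stack symbol $Z_0\in\Gamma$ and a set $F\subseteq Q$ of accepting states. A configuration is a pair in $Q\times\Gamma^*$; the language $L(P)\subseteq\Sigma^*$ consists of the words $w$ that label a finite sequence of transitions from $(q_0,Z_0)$ to a configuration whose state is in $F$. For $k\in\mathbb N$, the $k$-explorability game on $P$ is played with $k$ tokens, all placed initially on $(q_0,Z_0)$. In round $i\ge 1$, Spoiler chooses a letter $a_i\in\Sigma$, and then Determiner moves every token along some path of transitions of the form $\xrightarrow{\varepsilon}\cdots\xrightarrow{\varepsilon}\xrightarrow{a_i}$ (with zero or more $\varepsilon$-transitions). Determiner wins the play if for every $n$ with $a_1\cdots a_n\in L(P)$, some token is in a state of $F$ after round $n$ (for $n=0$: in the initial position). The PDA $P$ is $k$-explorable if Determiner has a winning strategy. Over a finite alphabet $\Sigma$,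 let $\mathsf{Expl}_k\text{-}\mathsf{CFL}$ be the class of languages recognised by $k$-explorable PDAs, let $\mathsf{Expl}\text{-}\mathsf{CFL}=\bigcup_{k\in\mathbb N}\mathsf{Expl}_k\text{-}\mathsf{CFL}$, and let $\mathsf{CFL}$ be the class of context-free languages. **Theorem.** $\mathsf{Expl}\text{-}\mathsf{CFL}\subsetneq\mathsf{CFL}$. More precisely, $\mathsf{Expl}\text{-}\mathsf{CFL}\subseteq\mathsf{CFL}$ over every finite alphabet, and over the alphabet $\{a,\#,b\}$ the inclusion is strict: the language $$L_{block}=\{a^{m_1}\#a^{m_2}\#\cdots a^{m_r}\#\,b^n \;:\; r\ge 1,\ m_1,\dots,m_r\ge 0,\ n\in\{m_1,\dots,m_r\}\}$$ is context-free, but for no $k\in\mathbb N$ is it recognised by a $k$-explorable PDA. -/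

import Mathlib

/-- A nondeterministic pushdown automaton over the input alphabet `α`, with finitely many states and
stack symbols. In `δ q x X`, the value `x = none` stands for an `ε`-transition; a transition replaces
the topmost stack symbol `X` by a string of at most two stack symbols. -/
structure PDA (α : Type*) where
  /-- States. -/
  Q : Type
  /-- Stack symbols. -/
  Γ : Type
  finite_Q : Finite Q
  finite_Γ : Finite Γ
  /-- Transition function. -/
  δ : Q → Option α → Γ → Set (Q × {γ : List Γ // γ.length ≤ 2})
  /-- Initial state. -/
  q₀ : Q
  /-- Initial stack symbol. -/
  Z₀ : Γ
  /-- Accepting states. -/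
  F : Set Q

namespace PDA

/-- A configuration: the control state and the stack content, whose head is the top of the stack. -/
abbrev Config {α : Type*} (P : PDA α) : Type := P.Q × List P.Γ

/-- The initial configuration. -/
def init {α : Type*} (P : PDA α) : P.Config := (P.q₀, [P.Z₀])

/-- One transition, labelled by a letter or by `ε` (`none`). Nothing is enabled on the empty stack. -/
inductive Move {α : Type*} (P : PDA α) : Option α → P.Config → P.Config → Prop
  | mk {x : Option α} {q q' : P.Q} {X : P.Γ} {γ : {γ : List P.Γ // γ.length ≤ 2}}
      (h : (q', γ) ∈ P.δ q x X) (β : List P.Γ) : Move P x (q, X :: β) (q', γ.1 ++ β)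

/-- `P.Run c w c'`: some finite sequence of transitions leads from `c` to `c'` and has label `w`,
where `ε`-transitions contribute nothing to the label. -/
inductive Run {α : Type*} (P : PDA α) : P.Config → List α → P.Config → Prop
  | refl (c : P.Config) : Run P c [] c
  | eps {c d e : P.Config} {w : List α} (h : P.Move none c d) (hr : Run P d w e) : Run P c w e
  | letter {c d e : P.Config} {a : α} {w : List α} (h : P.Move (some a) c d) (hr : Run P d w e) :
      Run P c (a :: w) e

/-- The language recognised by `P`, by acceptance in an accepting state. -/
def language {α : Type*} (P : PDA α) : Language α :=
  {w | ∃ c : P.Config, P.Run P.init w c ∧ c.1 ∈ P.F}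

/-- A legal move of one token when the letter `a` is played: a path of the form
`ε ⋯ ε a`, that is, finitely many `ε`-transitions followed by one transition that reads `a`. -/
def TokenStep {α : Type*} (P : PDA α) (a : α) (c c' : P.Config) : Prop :=
  ∃ d : P.Config, Relation.ReflTransGen (P.Move none) c d ∧ P.Move (some a) d c'

/-- A strategy of Determiner in the `k`-explorability game on `P`: `conf w` is the `k`-tuple of
configurations that she has reached after Spoiler has played the letters of `w`, one at a time.
(As her strategy is deterministic, the letters played so far determine the whole history.)
All tokens start in the initial configuration, and in every round every token makes a legal move. -/
structure Strategy {α : Type*} (P : PDA α) (k : ℕ) where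
  /-- The tuple of configurations after each finite word. -/
  conf : List α → Fin k → P.Config
  conf_nil : ∀ l, conf [] l = P.init
  conf_append : ∀ (w : List α) (a : α) (l : Fin k), P.TokenStep a (conf w l) (conf (w ++ [a]) l)

/-- The strategy wins every play: whenever the word played so far is in the language of `P`, the
sequence of configurations of some token is an accepting run on it, i.e. it is now in an accepting
state. -/
def Strategy.Winning {α : Type*} {P : PDA α} {k : ℕ} (σ : P.Strategy k) : Prop :=
  ∀ w ∈ P.language, ∃ l : Fin k, (σ.conf w l).1 ∈ P.F

/-- `P` is `k`-explorable: Determiner has a winning strategy in the `k`-explorability game. -/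
def IsExplorable {α : Type*} (P : PDA α) (k : ℕ) : Prop :=
  ∃ σ : P.Strategy k, σ.Winning

end PDA

/-- The class of languages over `α` recognised by `k`-explorable pushdown automata. -/
def ExplCFLWith (α : Type*) (k : ℕ) : Set (Language α) :=
  {L | ∃ P : PDA α, P.IsExplorable k ∧ P.language = L}

/-- The class of languages over `α` recognised by explorable pushdown automata. -/
def ExplCFL (α : Type*) : Set (Language α) := ⋃ k : ℕ, ExplCFLWith α k

/-- The class of context-free languages over `α`. -/
def CFL (α : Type*) : Set (Language α) := {L | L.IsContextFree}

/-- The alphabet `{a, #, b}`; `sep` is the separator `#`. -/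
inductive BlockLetter : Type
  | a
  | sep
  | b

/-- The words `a^{m₁} # a^{m₂} # ⋯ a^{mᵣ} # bⁿ` such that `n` is one of `m₁, …, mᵣ`. -/
def blockLanguage : Language BlockLetter :=
  {w | ∃ (ms : List ℕ) (n : ℕ), n ∈ ms ∧
    w = (ms.map fun m => List.replicate m BlockLetter.a ++ [BlockLetter.sep]).flatten ++
      List.replicate n BlockLetter.b}

/-! The inclusion is the triple construction: pushdown languages are context-free
(`language_eq_yields`). A grammar producing the chosen block together with the final `b`s shows that
`blockLanguage` is context-free.

For non-explorability, let Spoiler play `U = a^p # a^(p+1) # ⋯ a^(p+k) #` and then letters `b`. All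
`k + 1` words `U b^(p+j)` with `j ≤ k` are in the language, so by pigeonhole one of the `k` tokens
is accepting after two of them: a single run accepts `U b^(p+i)` and later `U b^(p+j)`, with `i <
j`.

The automaton `twoPhase` turns such doubly accepting runs into a pushdown language, the tags
recording which letters precede the first acceptance. Ogden-style pumping (`Yields.exists_pumping`)
applies there, the first-phase `b`s being marked. Both the number of first-phase `b`s and the
strictly larger total number of `b`s must remain block lengths while they grow. But one pumped
factor is spent on the `b`s, and the other can enlarge at most one block (`not_pumping`). -/

/-- The words generated by a nonterminal, for a set of rules of the form `A → x B₁ ⋯ Bₘ` with at most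
one letter `x` and `m ≤ 2` nonterminals. The derivation of a word is the tree of its derivation. -/
inductive Yields {α N : Type*} (R : N → Option α → List N → Prop) : N → List α → Prop
  | leaf {A : N} {x : Option α} (h : R A x []) : Yields R A x.toList
  | unary {A B : N} {x : Option α} {w : List α} (h : R A x [B]) (hB : Yields R B w) :
      Yields R A (x.toList ++ w)
  | binary {A B C : N} {x : Option α} {v w : List α} (h : R A x [B, C]) (hB : Yields R B v)
      (hC : Yields R C w) : Yields R A (x.toList ++ (v ++ w))

namespace Yields

/-! ### Grammars in normal form and context-free languages -/

section ContextFree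

variable {α : Type*} {N : Type} (R : N → Option α → List N → Prop)

/-- The context-free rule `A → x B₁ ⋯ Bₘ`. -/
def toRule (p : N × Option α × List N) : ContextFreeRule α N :=
  ⟨p.1, p.2.1.toList.map Symbol.terminal ++ p.2.2.map Symbol.nonterminal⟩

/-- The rules with at most two nonterminals on the right, as a set of context-free rules. -/
def ruleSet : Set (ContextFreeRule α N) :=
  toRule '' {p | R p.1 p.2.1 p.2.2 ∧ p.2.2.length ≤ 2}

/-- This is why `ruleSet` bounds the right-hand sides; `Yields` never uses longer ones, so nothing
is lost. -/
theorem finite_ruleSet [Finite α] [Finite N] : (ruleSet R).Finite := by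
  refine Set.Finite.image _ (Set.Finite.subset
    (Set.finite_univ.prod (Set.finite_univ.prod (List.finite_length_le N 2))) ?_)
  rintro ⟨A, x, Bs⟩ ⟨-, h⟩
  exact ⟨trivial, trivial, h⟩

/-- The context-free grammar with the given rules and initial nonterminal. -/
noncomputable def toGrammar [Finite α] [Finite N] (S : N) : ContextFreeGrammar α where
  NT := N
  initial := S
  rules := (finite_ruleSet R).toFinset

/-- The words obtained from a sentential form by replacing each nonterminal by a word which it
generates. -/
def interpret (s : List (Symbol α N)) : Language α :=
  (s.map fun y => match y with
    | .terminal a => ({[a]} : Language α)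
    | .nonterminal A => ({w | Yields R A w} : Language α)).prod

theorem interpret_append (s t : List (Symbol α N)) :
    interpret R (s ++ t) = interpret R s * interpret R t := by
  simp [interpret]

theorem interpret_terminal (w : List α) : interpret R (w.map Symbol.terminal) = {w} := by
  induction w with
  | nil => rfl
  | cons a w ih =>
    have : interpret R ((a :: w).map Symbol.terminal)
        = ({[a]} : Language α) * interpret R (w.map Symbol.terminal) := by
      simp [interpret]
    rw [this, ih]
    ext v
    constructor
    · rintro ⟨_, rfl, _, rfl, rfl⟩
      rfl
    · rintro rfl
      exact ⟨_, rfl, _, rfl, rfl⟩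

theorem interpret_nonterminal (A : N) :
    interpret R [Symbol.nonterminal A] = ({w | Yields R A w} : Language α) :=
  mul_one _

theorem interpret_rule {A : N} {x : Option α} {Bs : List N} (h : R A x Bs) (hl : Bs.length ≤ 2) :
    interpret R (toRule (A, x, Bs)).output ≤ interpret R [Symbol.nonterminal A] := by
  intro w hw
  rw [interpret_nonterminal]
  change Yields R A w
  simp only [toRule, interpret_append, interpret_terminal] at hw
  obtain ⟨u, rfl, v, hv, rfl⟩ := Language.mem_mul.1 hw
  match Bs, h, hl, hv with
  | [], h, _, hv =>
    obtain rfl : v = [] := hv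
    simpa using leaf h
  | [B], h, _, hv =>
    rw [List.map_singleton, interpret_nonterminal] at hv
    exact unary h hv
  | [B, C], h, _, hv =>
    rw [List.map_cons, List.map_singleton, ← List.singleton_append, interpret_append,
      interpret_nonterminal, interpret_nonterminal] at hv
    obtain ⟨v₁, h₁, v₂, h₂, rfl⟩ := Language.mem_mul.1 hv
    exact binary h h₁ h₂

/-- Soundness of the grammar: a rewriting step can only shrink the interpretation, and a terminal
word is interpreted as the singleton of itself. -/
theorem interpret_derives [Finite α] [Finite N] {S : N} {s t : List (Symbol α N)}
    (h : (toGrammar R S).Derives s t) : interpret R t ≤ interpret R s := by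
  induction h with
  | refl => exact le_rfl
  | tail _ hp ih =>
    refine le_trans ?_ ih
    obtain ⟨r, hr, hrw⟩ := hp
    obtain ⟨p, q, rfl, rfl⟩ := hrw.exists_parts
    obtain ⟨⟨A, x, Bs⟩, ⟨hR, hl⟩, rfl⟩ := (Set.Finite.mem_toFinset _).1 hr
    refine (interpret_append R _ q).le.trans (le_trans ?_ (interpret_append R _ q).ge)
    refine mul_le_mul' ((interpret_append R p _).le.trans ?_) le_rfl
    exact le_trans (mul_le_mul' le_rfl (interpret_rule R hR hl)) (interpret_append R p _).ge

variable {R} in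
theorem derives [Finite α] [Finite N] {S A : N} {w : List α} (h : Yields R A w) :
    (toGrammar R S).Derives [Symbol.nonterminal A] (w.map Symbol.terminal) := by
  have start : ∀ {A : N} {x : Option α} {Bs : List N}, R A x Bs → Bs.length ≤ 2 →
      (toGrammar R S).Derives [Symbol.nonterminal A]
        (x.toList.map Symbol.terminal ++ Bs.map Symbol.nonterminal) := fun {A x Bs} hR hl =>
    ContextFreeGrammar.Produces.single ⟨toRule (A, x, Bs),
      (Set.Finite.mem_toFinset _).2 ⟨(A, x, Bs), ⟨hR, hl⟩, rfl⟩,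
      ContextFreeRule.Rewrites.input_output⟩
  induction h with
  | leaf h => exact (List.append_nil (List.map Symbol.terminal _)) ▸ start h (by simp)
  | unary h _ ih =>
    rw [List.map_append]
    exact (start h (by simp)).trans (ih.append_left _)
  | binary h _ _ ihB ihC =>
    rw [List.map_append, List.map_append]
    refine (start h (by simp)).trans (ContextFreeGrammar.Derives.append_left ?_ _)
    exact (ihB.append_right [_]).trans (ihC.append_left _)

theorem isContextFree [Finite α] [Finite N] (S : N) :
    Language.IsContextFree ({w | Yields R S w} : Language α) := by
  refine ⟨toGrammar R S, ?_⟩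
  ext w
  refine Iff.trans (ContextFreeGrammar.mem_language_iff _ _) ⟨fun h => ?_, fun h => h.derives⟩
  have hw : w ∈ interpret R (w.map Symbol.terminal) := (interpret_terminal R w).ge rfl
  exact (interpret_nonterminal R S).le (interpret_derives R h hw)

end ContextFree

/-! ### Ogden-style pumping -/

section Pumping

variable {α N : Type*} {R : N → Option α → List N → Prop}

/-- `Context R A u B z`: a derivation from `B` can be completed to one from `A` that has
`u` to the left and `z` to the right. -/
def Context (R : N → Option α → List N → Prop) (A : N) (u : List α) (B : N) (z : List α) : Prop :=
  ∀ x, Yields R B x → Yields R A (u ++ (x ++ z))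

theorem Context.refl (A : N) : Context R A [] A [] := fun x hx => by simpa using hx

theorem Context.trans {A B C : N} {u v y z : List α} (h : Context R A u B z)
    (h' : Context R B v C y) : Context R A (u ++ v) C (y ++ z) := fun x hx => by
  simpa using h _ (h' x hx)

theorem Context.iterate {A : N} {v y : List α} (h : Context R A v A y) (i : ℕ) :
    Context R A (List.replicate i v).flatten A (List.replicate i y).flatten := by
  induction i with
  | zero => exact Context.refl A
  | succ i ih =>
    rw [List.replicate_succ, List.replicate_succ', List.flatten_cons, List.flatten_append]
    simpa using h.trans ih

/-- A derivation from `A` of `w` contains a loop, from a nonterminal to itself, to whose sides the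
letter `c` occurs. -/
def Loops [BEq α] (R : N → Option α → List N → Prop) (c : α) (A : N) (w : List α) : Prop :=
  ∃ (B : N) (u v x y z : List α), w = u ++ (v ++ (x ++ (y ++ z))) ∧ Context R A u B z ∧
    Context R B v B y ∧ Yields R B x ∧ 0 < v.count c + y.count c

theorem Loops.of_context [BEq α] {c : α} {A B : N} {u x z : List α}
    (hC : Context R A u B z) (h : Loops R c B x) : Loops R c A (u ++ (x ++ z)) := by
  obtain ⟨D, u', v, x, y, z', rfl, h₁, h₂, h₃, h₄⟩ := h
  exact ⟨D, u ++ u', v, x, y, z' ++ z, by simp, hC.trans h₁, h₂, h₃, h₄⟩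

/-- The derivation from `A` of `w` passes through some nonterminal in `S`. -/
def Visits (R : N → Option α → List N → Prop) (S : Finset N) (A : N) (w : List α) : Prop :=
  ∃ B ∈ S, ∃ u x z : List α, w = u ++ (x ++ z) ∧ Context R A u B z ∧ Yields R B x

theorem Visits.of_context {S : Finset N} {A B : N} {u x z : List α} (hC : Context R A u B z)
    (h : Visits R S B x) : Visits R S A (u ++ (x ++ z)) := by
  obtain ⟨D, hD, u', x, z', rfl, h₁, h₂⟩ := h
  exact ⟨D, hD, u ++ u', x, z' ++ z, by simp, hC.trans h₁, h₂⟩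

/-- The induction step of `loops_or_visits`: pass from a node to a child `B` which carries
a fair share of the occurrences of `c`. -/
theorem loops_or_visits_of_child [BEq α] [DecidableEq N] [Fintype N] {c : α} {A B : N}
    {u x z : List α} {S : Finset N} (hC : Context R A u B z) (hB : Yields R B x)
    (ih : ∀ S : Finset N, 3 ^ Sᶜ.card ≤ x.count c → Loops R c B x ∨ Visits R S B x)
    (hA : A ∉ S) (hS : 3 ^ Sᶜ.card ≤ (u ++ (x ++ z)).count c)
    (hx : (u ++ (x ++ z)).count c ≤ 2 * x.count c + 1) :
    Loops R c A (u ++ (x ++ z)) ∨ Visits R S A (u ++ (x ++ z)) := by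
  -- If `B` carries every `c`, a loop closing at `A` here might pump no `c`, so `A` is not recorded
  -- in `S`; the threshold need not drop either.
  by_cases heq : x.count c = (u ++ (x ++ z)).count c
  · exact (ih S (heq ▸ hS)).imp (Loops.of_context hC) (Visits.of_context hC)
  have hcard : Sᶜ.card = (insert A S)ᶜ.card + 1 := by
    have h₁ := Finset.card_compl_add_card S
    have h₂ := Finset.card_compl_add_card (insert A S)
    rw [Finset.card_insert_of_notMem hA] at h₂
    omega
  -- The base 3 absorbs the extra letter of the rule: `3t ≤ 2n + 1` with `t ≥ 1` forces `t ≤ n`.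
  rw [hcard, pow_succ] at hS
  have hpos : 0 < 3 ^ (insert A S)ᶜ.card := by positivity
  rcases ih (insert A S) (by omega) with h | ⟨D, hD, u', x', z', rfl, h₁, h₂⟩
  · exact Or.inl (h.of_context hC)
  rcases Finset.mem_insert.1 hD with rfl | hD
  -- The derivation returns to `A`. Some `c` was lost in passing to the child, so it lies beside
  -- this loop.
  · refine Or.inl ⟨D, [], u ++ u', x', z' ++ z, [], by simp, Context.refl D, hC.trans h₁, h₂, ?_⟩
    simp only [List.count_append] at heq ⊢
    by_contra h0
    omega
  · exact Or.inr (Visits.of_context hC ⟨D, hD, u', x', z', rfl, h₁, h₂⟩)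

/-- Descend to the child richest in `c`. The set `S` holds the nonterminals at which occurrences of
`c` split off; each new one costs a factor 3, and meeting one again closes a loop. For `S = ∅` only
the loop is possible. -/
theorem loops_or_visits [BEq α] [DecidableEq N] [Fintype N] {A : N} {w : List α}
    (h : Yields R A w) (c : α) (S : Finset N) (hS : 3 ^ Sᶜ.card ≤ w.count c) :
    Loops R c A w ∨ Visits R S A w := by
  have hx : ∀ x : Option α, x.toList.count c ≤ 1 := fun x =>
    (List.count_le_length).trans (by cases x <;> simp)
  induction h generalizing S with
  | @leaf A x h =>
    by_cases hA : A ∈ S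
    · exact Or.inr ⟨A, hA, [], x.toList, [], by simp, Context.refl A, leaf h⟩
    have hpos : 0 < Sᶜ.card := Finset.card_pos.2 ⟨A, Finset.mem_compl.2 hA⟩
    have := Nat.one_lt_pow hpos.ne' (show 1 < 3 by norm_num)
    have := hx x
    omega
  | @unary A B x w h hB ih =>
    by_cases hA : A ∈ S
    · exact Or.inr ⟨A, hA, [], x.toList ++ w, [], by simp, Context.refl A, unary h hB⟩
    have hC : Context R A x.toList B [] := fun w hw => by simpa using unary h hw
    have key := loops_or_visits_of_child hC hB (c := c) (S := S) ih hA
    simp only [List.append_nil] at key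
    refine key hS ?_
    have := hx x
    simp only [List.count_append]
    omega
  | @binary A B C x v w h hB hC ihB ihC =>
    by_cases hA : A ∈ S
    · exact Or.inr ⟨A, hA, [], x.toList ++ (v ++ w), [], by simp, Context.refl A, binary h hB hC⟩
    have := hx x
    rcases le_total (w.count c) (v.count c) with hle | hle
    · have hctx : Context R A x.toList B w := fun v hv => binary h hv hC
      refine loops_or_visits_of_child hctx hB ihB hA hS ?_
      simp only [List.count_append]
      omega
    · have hctx : Context R A (x.toList ++ v) C [] := fun w hw => by simpa using binary h hB hw
      have key := loops_or_visits_of_child hctx hC (c := c) (S := S) ihC hA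
      simp only [List.append_nil, List.append_assoc] at key
      refine key hS ?_
      simp only [List.count_append]
      omega

/-- A variant of Ogden's lemma: a word with sufficiently many occurrences of the letter `c` can be
pumped, the pumped part containing `c`. -/
theorem exists_pumping [BEq α] [Finite N] (R : N → Option α → List N → Prop) (c : α)
    (A : N) : ∃ p : ℕ, ∀ w, Yields R A w → p ≤ w.count c →
      ∃ u v x y z : List α, w = u ++ (v ++ (x ++ (y ++ z))) ∧ 0 < v.count c + y.count c ∧
        ∀ i : ℕ, Yields R A
          (u ++ ((List.replicate i v).flatten ++ (x ++ ((List.replicate i y).flatten ++ z)))) := by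
  classical
  have := Fintype.ofFinite N
  refine ⟨3 ^ (∅ : Finset N)ᶜ.card, fun w hw hc => ?_⟩
  rcases loops_or_visits hw c ∅ hc with ⟨B, u, v, x, y, z, rfl, h₁, h₂, h₃, h₄⟩ | ⟨B, hB, -⟩
  · exact ⟨u, v, x, y, z, rfl, h₄, fun i => by simpa using h₁ _ (h₂.iterate i x h₃)⟩
  · simp at hB

end Pumping

end Yields
-- The triple construction
namespace PDA

variable {α : Type*} (P : PDA α)

variable {P} in
theorem Run.trans {c d e : P.Config} {v w : List α} (h : P.Run c v d) (h' : P.Run d w e) :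
    P.Run c (v ++ w) e := by
  induction h with
  | refl => exact h'
  | eps hm _ ih => exact .eps hm (ih h')
  | letter hm _ ih => exact .letter hm (ih h')

variable {P} in
theorem Run.cons {x : Option α} {c d e : P.Config} {w : List α} (h : P.Move x c d)
    (h' : P.Run d w e) : P.Run c (x.toList ++ w) e := by
  cases x with
  | none => exact .eps h h'
  | some a => exact .letter h h'

variable {P} in
@[elab_as_elim]
theorem Run.rec_cons {e : P.Config} {motive : ∀ c w, P.Run c w e → Prop}
    (refl : motive e [] (.refl e))
    (cons : ∀ {x : Option α} {c d : P.Config} {w : List α} (hm : P.Move x c d) (hr : P.Run d w e),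
      motive d w hr → motive c (x.toList ++ w) (Run.cons hm hr)) {c : P.Config} {w : List α}
    (h : P.Run c w e) : motive c w h := by
  induction h with
  | refl => exact refl
  | eps hm hr ih => exact cons (x := none) hm hr (ih refl cons)
  | letter hm hr ih => exact cons (x := some _) hm hr (ih refl cons)

/-- The rules of the triple construction. The nonterminal `(p, X, some q)` stands for the runs
from state `p` to state `q` whose effect is to pop `X`; the nonterminal `(p, X, none)` stands for
the runs from `p`, with `X` on top of the stack, to an accepting state. -/
inductive TripleRule : P.Q × P.Γ × Option P.Q → Option α → List (P.Q × P.Γ × Option P.Q) → Prop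
  | halt {p : P.Q} {X : P.Γ} (hp : p ∈ P.F) : TripleRule (p, X, none) none []
  | pop {p q : P.Q} {X : P.Γ} {x : Option α} {γ : {γ : List P.Γ // γ.length ≤ 2}}
      (h : (q, γ) ∈ P.δ p x X) (hγ : γ.1 = []) : TripleRule (p, X, some q) x []
  | pop_halt {p q : P.Q} {X : P.Γ} {x : Option α} {γ : {γ : List P.Γ // γ.length ≤ 2}}
      (h : (q, γ) ∈ P.δ p x X) (hγ : γ.1 = []) (hq : q ∈ P.F) : TripleRule (p, X, none) x []
  -- When `o = none` the symbols `β` below `Y` may stay untouched until acceptance, so `β` is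
  -- arbitrary.
  | top {p q : P.Q} {X Y : P.Γ} {β : List P.Γ} {o : Option P.Q} {x : Option α}
      {γ : {γ : List P.Γ // γ.length ≤ 2}} (h : (q, γ) ∈ P.δ p x X) (hγ : γ.1 = Y :: β)
      (ho : β = [] ∨ o = none) : TripleRule (p, X, o) x [(q, Y, o)]
  | push {p q r : P.Q} {X Y Z : P.Γ} {o : Option P.Q} {x : Option α}
      {γ : {γ : List P.Γ // γ.length ≤ 2}} (h : (q, γ) ∈ P.δ p x X) (hγ : γ.1 = [Y, Z]) :
      TripleRule (p, X, o) x [(q, Y, some r), (r, Z, o)]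

/-- The runs that a nonterminal of the triple construction stands for. -/
def TripleRun (β : List P.Γ) (w : List α) : P.Q × P.Γ × Option P.Q → Prop
  | (p, X, some q) => P.Run (p, X :: β) w (q, β)
  | (p, X, none) => ∃ c : P.Config, P.Run (p, X :: β) w c ∧ c.1 ∈ P.F

variable {P} in
theorem TripleRun.prepend {p q : P.Q} {X Y : P.Γ} {o : Option P.Q} {β β' : List P.Γ}
    {v w : List α} (h : P.Run (p, X :: β) v (q, Y :: β')) (ho : β' = β ∨ o = none)
    (h' : P.TripleRun β' w (q, Y, o)) : P.TripleRun β (v ++ w) (p, X, o) := by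
  cases o with
  | some r =>
    obtain rfl : β' = β := by simpa using ho
    exact h.trans h'
  | none =>
    obtain ⟨c, hc, hF⟩ := h'
    exact ⟨c, h.trans hc, hF⟩

theorem run_singleton {x : Option α} {p q : P.Q} {X : P.Γ} {γ : {γ : List P.Γ // γ.length ≤ 2}}
    (h : (q, γ) ∈ P.δ p x X) (β : List P.Γ) : P.Run (p, X :: β) x.toList (q, γ.1 ++ β) := by
  simpa using Run.cons (Move.mk h β) (.refl _)

theorem tripleRun_of_yields {t : P.Q × P.Γ × Option P.Q} {w : List α}
    (h : Yields P.TripleRule t w) : ∀ β, P.TripleRun β w t := by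
  induction h with
  | leaf h =>
    intro β
    cases h with
    | halt hp => exact ⟨_, .refl _, hp⟩
    | pop h hγ => simpa [hγ, TripleRun] using P.run_singleton h β
    | pop_halt h hγ hq => exact ⟨_, P.run_singleton h β, hq⟩
  | unary h _ ih =>
    intro β
    cases h with
    | top h hγ ho =>
      have hr := P.run_singleton h β
      rw [hγ] at hr
      exact TripleRun.prepend hr (ho.imp_left fun h => by simp [h]) (ih _)
  | binary h _ _ ihB ihC =>
    intro β
    cases h with
    | push h hγ =>
      have hr := P.run_singleton h β
      rw [hγ] at hr
      rw [← List.append_assoc]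
      exact TripleRun.prepend (hr.trans (ihB _)) (Or.inl rfl) (ihC β)

/-- Needed for runs that accept on the empty stack, having popped `Z₀`. Along the rightmost branch
the final `pop` becomes `pop_halt`. -/
theorem yields_none_of_yields_some {t : P.Q × P.Γ × Option P.Q} {w : List α}
    (h : Yields P.TripleRule t w) : ∀ {p : P.Q} {X : P.Γ} {q : P.Q}, t = (p, X, some q) → q ∈ P.F →
      Yields P.TripleRule (p, X, none) w := by
  induction h with
  | leaf h =>
    rintro p X q rfl hq
    cases h with
    | pop h hγ => exact .leaf (.pop_halt h hγ hq)
  | unary h _ ih =>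
    rintro p X q rfl hq
    cases h with
    | top h hγ ho => exact .unary (.top h hγ (Or.inr rfl)) (ih rfl hq)
  | binary h hB _ _ ihC =>
    rintro p X q rfl hq
    cases h with
    | push h hγ => exact .binary (.push h hγ) hB (ihC rfl hq)

/-- A decomposition of an accepting run from a configuration according to the symbols of the stack
that it pops. -/
inductive Forest : P.Q → List P.Γ → List α → Prop
  | nil {p : P.Q} (hp : p ∈ P.F) : Forest p [] []
  | last {p : P.Q} {X : P.Γ} {β : List P.Γ} {w : List α}
      (h : Yields P.TripleRule (p, X, none) w) : Forest p (X :: β) w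
  | cons {p q : P.Q} {X : P.Γ} {β : List P.Γ} {v w : List α}
      (h : Yields P.TripleRule (p, X, some q) v) (hf : Forest q β w) : Forest p (X :: β) (v ++ w)

/-- A transition read backwards gathers the trees of the symbols it pushes under one root, the
symbol it consumes. -/
theorem forest_of_move {x : Option α} {c d : P.Config} {w : List α} (hm : P.Move x c d)
    (h : P.Forest d.1 d.2 w) : P.Forest c.1 c.2 (x.toList ++ w) := by
  obtain @⟨p, q, X, γ, hδ, β⟩ := hm
  have hlen := γ.2
  match hγ : γ.1, hlen with
  | [], _ =>
    simp only [hγ, List.nil_append] at h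
    exact .cons (.leaf (.pop hδ hγ)) h
  | [Y], _ =>
    simp only [hγ, List.cons_append, List.nil_append] at h
    cases h with
    | last h => exact .last (.unary (.top hδ hγ (Or.inl rfl)) h)
    | cons h hf =>
      rw [← List.append_assoc]
      exact .cons (.unary (.top hδ hγ (Or.inl rfl)) h) hf
  | [Y, Z], _ =>
    simp only [hγ, List.cons_append, List.nil_append] at h
    cases h with
    | last h => exact .last (.unary (.top hδ hγ (Or.inr rfl)) h)
    | cons h hf =>
      cases hf with
      | last h' => exact .last (.binary (.push hδ hγ) h h')
      | cons h' hf =>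
        rw [← List.append_assoc, ← List.append_assoc, List.append_assoc x.toList]
        exact .cons (.binary (.push hδ hγ) h h') hf

theorem forest_of_run {c d : P.Config} {w : List α} (h : P.Run c w d) (hd : d.1 ∈ P.F) :
    P.Forest c.1 c.2 w := by
  induction h using Run.rec_cons with
  | refl =>
    obtain ⟨p, β⟩ := d
    cases β with
    | nil => exact .nil hd
    | cons X β => exact .last (.leaf (TripleRule.halt hd))
  | cons hm _ ih => exact P.forest_of_move hm ih

theorem language_eq_yields :
    P.language = ({w | Yields P.TripleRule (P.q₀, P.Z₀, none) w} : Language α) := by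
  ext w
  constructor
  · rintro ⟨c, hr, hc⟩
    have hf : P.Forest P.q₀ [P.Z₀] w := P.forest_of_run hr hc
    cases hf with
    | last h => exact h
    | cons h hf =>
      cases hf with
      | nil hq =>
        rw [List.append_nil]
        exact P.yields_none_of_yields_some h rfl hq
  · exact fun h => P.tripleRun_of_yields h []

theorem isContextFree_language [Finite α] : P.language.IsContextFree := by
  have := P.finite_Q
  have := P.finite_Γ
  rw [language_eq_yields]
  exact Yields.isContextFree _ _

theorem exists_pumping [BEq α] (c : α) : ∃ p : ℕ, ∀ w ∈ P.language, p ≤ w.count c →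
    ∃ u v x y z : List α, w = u ++ (v ++ (x ++ (y ++ z))) ∧ 0 < v.count c + y.count c ∧
      ∀ i : ℕ, u ++ ((List.replicate i v).flatten ++ (x ++ ((List.replicate i y).flatten ++ z)))
        ∈ P.language := by
  have := P.finite_Q
  have := P.finite_Γ
  rw [language_eq_yields]
  exact Yields.exists_pumping P.TripleRule c (P.q₀, P.Z₀, none)

/-! ### Words accepted twice along one run -/

/-- The automaton which reads words whose letters carry a Boolean tag. It behaves as `P`, first
reading letters tagged `false`; once, in an accepting state, it may start to read letters
tagged `true`. -/
def twoPhase : PDA (α × Bool) where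
  Q := P.Q × Bool
  Γ := P.Γ
  finite_Q := have := P.finite_Q; inferInstance
  finite_Γ := P.finite_Γ
  δ p x X := {r | (r.1.2 = p.2 ∧ ∃ y : Option α, x = y.map (·, p.2) ∧ (r.1.1, r.2) ∈ P.δ p.1 y X) ∨
    (p.2 = false ∧ r.1.2 = true ∧ x = none ∧ p.1 ∈ P.F ∧ r.1.1 = p.1 ∧ r.2.1 = [X])}
  q₀ := (P.q₀, false)
  Z₀ := P.Z₀
  F := {p | p.1 ∈ P.F ∧ p.2 = true}

theorem twoPhase_run {c d : P.Config} {w : List α} (h : P.Run c w d) (t : Bool) :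
    P.twoPhase.Run ((c.1, t), c.2) (w.map (·, t)) ((d.1, t), d.2) := by
  induction h using Run.rec_cons with
  | refl => exact .refl _
  | @cons x c' d' w hm _ ih =>
    obtain @⟨p, q, X, γ, hδ, β⟩ := hm
    have hδ' : ((q, t), γ) ∈ P.twoPhase.δ (p, t) (x.map (·, t)) X := Or.inl ⟨rfl, x, rfl, hδ⟩
    have hm : P.twoPhase.Move (x.map (·, t)) ((p, t), X :: β) ((q, t), γ.1 ++ β) := .mk hδ' β
    have := Run.cons hm ih
    cases x <;> exact this

/-- The change of phase is itself a transition and needs a symbol on the stack, whence `hs`. -/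
theorem twoPhase_mem {c d : P.Config} {v w : List α} (h : P.Run P.init v c) (hc : c.1 ∈ P.F)
    (hs : c.2 ≠ []) (h' : P.Run c w d) (hd : d.1 ∈ P.F) :
    v.map (·, false) ++ w.map (·, true) ∈ P.twoPhase.language := by
  refine ⟨((d.1, true), d.2), (P.twoPhase_run h false).trans ?_, hd, rfl⟩
  obtain ⟨p, β⟩ := c
  obtain ⟨X, β, rfl⟩ := List.exists_cons_of_ne_nil hs
  have hδ : ((p, true), ⟨[X], Nat.le_succ 1⟩) ∈ P.twoPhase.δ (p, false) none X :=
    Or.inr ⟨rfl, rfl, rfl, hc, rfl, rfl⟩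
  have hm : P.twoPhase.Move none ((p, false), X :: β) ((p, true), [X] ++ β) := .mk hδ β
  exact .eps hm (P.twoPhase_run h' true)

/-- The phase never returns from `true` to `false`, so a run changes phase at most once; `e` is the
configuration where it does. -/
theorem run_of_twoPhase_run {c d : P.twoPhase.Config} {w : List (α × Bool)}
    (h : P.twoPhase.Run c w d) :
    (c.1.2 = d.1.2 ∧ ∃ v, w = v.map (·, d.1.2) ∧ P.Run (c.1.1, c.2) v (d.1.1, d.2)) ∨
    (c.1.2 = false ∧ d.1.2 = true ∧ ∃ v v' e, w = v.map (·, false) ++ v'.map (·, true) ∧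
      P.Run (c.1.1, c.2) v e ∧ e.1 ∈ P.F ∧ P.Run e v' (d.1.1, d.2)) := by
  induction h using Run.rec_cons with
  | refl => exact Or.inl ⟨rfl, [], rfl, .refl _⟩
  | @cons x c' d' w hm _ ih =>
    obtain @⟨⟨p, t⟩, ⟨q, t'⟩, X, γ, hδ, β⟩ := hm
    rcases hδ with ⟨ht, y, hy, hδ⟩ | ⟨ht, ht', hx, hp, hpq, hγ⟩
    · obtain rfl : t' = t := ht
      simp only at hy hδ ih ⊢
      have hm : P.Move y (p, X :: β) (q, γ.1 ++ β) := .mk hδ β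
      rcases ih with ⟨ht, v, rfl, hv⟩ | ⟨ht, ht', v, v', e, rfl, hv, he, hv'⟩
      · refine Or.inl ⟨ht, y.toList ++ v, ?_, Run.cons hm hv⟩
        subst hy
        cases y <;> simp [ht]
      · refine Or.inr ⟨ht, ht', y.toList ++ v, v', e, ?_, Run.cons hm hv, he, hv'⟩
        subst hy
        cases y <;> simp [ht]
    · simp only at ht ht' hp hpq
      subst ht ht' hx hpq
      rcases ih with ⟨ht, v, rfl, hv⟩ | ⟨ht, -⟩
      · refine Or.inr ⟨rfl, ht.symm, [], v, (q, X :: β), ?_, .refl _, hp, ?_⟩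
        · simp at ht
          simp [← ht]
        · have hγ' : γ.1 ++ β = X :: β := congrArg (· ++ β) hγ
          exact (congrArg (fun s : List P.Γ => P.Run (q, s) v (d.1.1, d.2)) hγ').mp hv
      · simp at ht

theorem exists_of_mem_twoPhase_language {w : List (α × Bool)} (h : w ∈ P.twoPhase.language) :
    ∃ v v', w = v.map (·, false) ++ v'.map (·, true) ∧ v ∈ P.language ∧ v ++ v' ∈ P.language := by
  obtain ⟨c, hr, hF, hc⟩ := h
  rcases P.run_of_twoPhase_run hr with ⟨h, -⟩ | ⟨-, -, v, v', e, rfl, hv, he, hv'⟩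
  · rw [hc] at h
    exact absurd h Bool.false_ne_true
  · exact ⟨v, v', rfl, ⟨e, hv, he⟩, _, hv.trans hv', hF⟩

/-! ### Runs traced by the tokens -/

namespace Strategy

variable {P} {k : ℕ} (σ : P.Strategy k)

theorem run_of_tokenStep {a : α} {c d : P.Config} (h : P.TokenStep a c d) : P.Run c [a] d := by
  obtain ⟨e, he, hm⟩ := h
  induction he using Relation.ReflTransGen.head_induction_on with
  | refl => exact .letter hm (.refl _)
  | head h _ ih => exact .eps h ih

theorem conf_run (v w : List α) (l : Fin k) : P.Run (σ.conf v l) w (σ.conf (v ++ w) l) := by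
  induction w using List.reverseRecOn with
  | nil => simpa using Run.refl _
  | append_singleton w a ih =>
    rw [← List.append_assoc]
    exact ih.trans (run_of_tokenStep (σ.conf_append _ _ _))

/-- Spoiler can always play another letter and every token must answer, which is impossible on the
empty stack. -/
theorem conf_ne_nil [Nonempty α] (v : List α) (l : Fin k) : (σ.conf v l).2 ≠ [] := by
  obtain ⟨a⟩ := ‹Nonempty α›
  intro h
  have nomove : ∀ {x c d}, P.Move x c d → c.2 ≠ [] := by
    rintro x c d ⟨-, -⟩
    simp
  obtain ⟨e, he, hm⟩ := σ.conf_append v a l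
  rcases Relation.ReflTransGen.cases_head he with rfl | ⟨d, hd, -⟩
  · exact nomove hm h
  · exact nomove hd h

end Strategy

end PDA
-- A grammar for the block language
/-- The word `a^{m₁} # a^{m₂} # ⋯ a^{mᵣ} #`. -/
def blockWord (ms : List ℕ) : List BlockLetter :=
  (ms.map fun m => List.replicate m BlockLetter.a ++ [BlockLetter.sep]).flatten

theorem blockWord_cons (m : ℕ) (ms : List ℕ) :
    blockWord (m :: ms) = List.replicate m .a ++ .sep :: blockWord ms := by
  simp [blockWord]

theorem mem_blockLanguage {w : List BlockLetter} :
    w ∈ blockLanguage ↔ ∃ ms n, n ∈ ms ∧ w = blockWord ms ++ List.replicate n .b := Iff.rfl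

/-- The nonterminals of a grammar for `blockLanguage`. -/
inductive BlockNT : Type
  | start
  | block
  | chosen
  | blocks
  | close

instance : Finite BlockNT :=
  Finite.of_surjective (![.start, .block, .chosen, .blocks, .close] : Fin 5 → BlockNT) <| by
    rintro (_ | _ | _ | _ | _)
    exacts [⟨0, rfl⟩, ⟨1, rfl⟩, ⟨2, rfl⟩, ⟨3, rfl⟩, ⟨4, rfl⟩]

/-- The rules of a grammar for `blockLanguage`: the chosen block is generated together with the
final letters `b`. -/
inductive BlockRule : BlockNT → Option BlockLetter → List BlockNT → Prop
  | skip : BlockRule .start none [.block, .start]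
  | choose : BlockRule .start none [.chosen]
  | block_a : BlockRule .block (some .a) [.block]
  | block_sep : BlockRule .block (some .sep) []
  | chosen_a : BlockRule .chosen (some .a) [.chosen, .close]
  | chosen_sep : BlockRule .chosen (some .sep) [.blocks]
  | blocks_nil : BlockRule .blocks none []
  | blocks_cons : BlockRule .blocks none [.block, .blocks]
  | close_b : BlockRule .close (some .b) []

/-- The words generated by the nonterminals. -/
def BlockNT.Spec : BlockNT → List BlockLetter → Prop
  | .start, w => w ∈ blockLanguage
  | .block, w => ∃ m, w = blockWord [m]
  | .chosen, w => ∃ n ms, w = blockWord (n :: ms) ++ List.replicate n .b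
  | .blocks, w => ∃ ms, w = blockWord ms
  | .close, w => w = [.b]

theorem BlockNT.spec_of_yields {A : BlockNT} {w : List BlockLetter} (h : Yields BlockRule A w) :
    A.Spec w := by
  induction h with
  | leaf h =>
    cases h with
    | block_sep => exact ⟨0, rfl⟩
    | blocks_nil => exact ⟨[], rfl⟩
    | close_b => exact rfl
  | unary h _ ih =>
    cases h with
    | choose =>
      obtain ⟨n, ms, rfl⟩ := ih
      exact ⟨n :: ms, n, by simp, rfl⟩
    | block_a =>
      obtain ⟨m, rfl⟩ := ih
      exact ⟨m + 1, by simp [blockWord, List.replicate_succ]⟩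
    | chosen_sep =>
      obtain ⟨ms, rfl⟩ := ih
      exact ⟨0, ms, by simp [blockWord_cons]⟩
  | binary h _ _ ihB ihC =>
    cases h with
    | skip =>
      obtain ⟨m, rfl⟩ := ihB
      obtain ⟨ms, n, hn, rfl⟩ := mem_blockLanguage.1 ihC
      exact ⟨m :: ms, n, by simp [hn], by simp [blockWord]⟩
    | chosen_a =>
      obtain ⟨n, ms, rfl⟩ := ihB
      obtain rfl := ihC
      exact ⟨n + 1, ms, by
        rw [List.replicate_succ' (a := BlockLetter.b)]
        simp [blockWord_cons, List.replicate_succ]⟩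
    | blocks_cons =>
      obtain ⟨m, rfl⟩ := ihB
      obtain ⟨ms, rfl⟩ := ihC
      exact ⟨m :: ms, by simp [blockWord]⟩

theorem yields_block (m : ℕ) : Yields BlockRule .block (blockWord [m]) := by
  induction m with
  | zero => exact .leaf BlockRule.block_sep
  | succ m ih =>
    have := Yields.unary .block_a ih
    simpa [blockWord, List.replicate_succ] using this

theorem yields_blocks (ms : List ℕ) : Yields BlockRule .blocks (blockWord ms) := by
  induction ms with
  | nil => exact .leaf BlockRule.blocks_nil
  | cons m ms ih =>
    have := Yields.binary .blocks_cons (yields_block m) ih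
    simpa [blockWord] using this

theorem yields_chosen (n : ℕ) (ms : List ℕ) :
    Yields BlockRule .chosen (blockWord (n :: ms) ++ List.replicate n .b) := by
  induction n with
  | zero =>
    have := Yields.unary .chosen_sep (yields_blocks ms)
    simpa [blockWord_cons] using this
  | succ n ih =>
    have := Yields.binary .chosen_a ih (.leaf BlockRule.close_b)
    rw [List.replicate_succ' (a := BlockLetter.b)]
    simpa [blockWord_cons, List.replicate_succ] using this

theorem yields_start {ms : List ℕ} {n : ℕ} (h : n ∈ ms) :
    Yields BlockRule .start (blockWord ms ++ List.replicate n .b) := by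
  induction ms with
  | nil => simp at h
  | cons m ms ih =>
    rcases List.mem_cons.1 h with rfl | h
    · exact .unary .choose (yields_chosen n ms)
    · have := Yields.binary .skip (yields_block m) (ih h)
      simpa [blockWord] using this

instance : Finite BlockLetter :=
  Finite.of_surjective (![.a, .sep, .b] : Fin 3 → BlockLetter) <| by
    rintro (_ | _ | _)
    exacts [⟨0, rfl⟩, ⟨1, rfl⟩, ⟨2, rfl⟩]

theorem isContextFree_blockLanguage : blockLanguage.IsContextFree := by
  have : blockLanguage = ({w | Yields BlockRule .start w} : Language BlockLetter) := by
    ext w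
    constructor
    · rintro ⟨ms, n, hn, rfl⟩
      exact yields_start hn
    · exact BlockNT.spec_of_yields
  rw [this]
  exact Yields.isContextFree _ _
-- Block lengths in factorised block words
instance : DecidableEq BlockLetter
  | .a, .a | .sep, .sep | .b, .b => isTrue rfl
  | .a, .sep | .a, .b | .sep, .a | .sep, .b | .b, .a | .b, .sep => isFalse (by simp)

theorem length_le_of_mem_blockWord {ms : List ℕ} {m : ℕ} (h : m ∈ ms) :
    m ≤ (blockWord ms).length := by
  induction ms with
  | nil => simp at h
  | cons m' ms ih =>
    simp only [blockWord_cons, List.length_append, List.length_replicate, List.length_cons]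
    rcases List.mem_cons.1 h with rfl | h
    · omega
    · have := ih h
      omega

theorem b_notMem_blockWord (ms : List ℕ) : BlockLetter.b ∉ blockWord ms := by
  simp [blockWord]

theorem blockWord_injective : Function.Injective blockWord := by
  have key : ∀ (m m' : ℕ) (s s' : List BlockLetter),
      List.replicate m BlockLetter.a ++ .sep :: s = List.replicate m' .a ++ .sep :: s' →
        m = m' ∧ s = s' := by
    intro m
    induction m with
    | zero => rintro (_ | m') s s' h <;> simp_all [List.replicate_succ]
    | succ m ih =>
      rintro (_ | m') s s' h
      · simp [List.replicate_succ] at h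
      · simpa using ih m' s s' (by simpa [List.replicate_succ] using h)
  intro ms
  induction ms with
  | nil => rintro (_ | ⟨m', ms'⟩) h <;> simp_all [blockWord]
  | cons m ms ih =>
    rintro (_ | ⟨m', ms'⟩) h
    · simp [blockWord] at h
    · rw [blockWord_cons, blockWord_cons] at h
      obtain ⟨rfl, hs⟩ := key _ _ _ _ h
      rw [ih hs]

/-- A separator splits the list of blocks. -/
theorem le_length_or_mem_of_blockWord_eq_append_sep {ms : List ℕ} {l r : List BlockLetter}
    (h : blockWord ms = l ++ .sep :: r) {m : ℕ} (hm : m ∈ ms) :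
    m ≤ l.length ∨ ∃ ms', blockWord ms' = r ∧ m ∈ ms' := by
  induction ms generalizing l with
  | nil => simp at hm
  | cons m₀ ms ih =>
    rw [blockWord_cons] at h
    rcases List.append_eq_append_iff.1 h with ⟨as, rfl, has⟩ | ⟨bs, hbs, hr⟩
    · rcases as with _ | ⟨c, as⟩
      · obtain rfl : blockWord ms = r := by simpa using has
        rcases List.mem_cons.1 hm with rfl | hm
        · simp
        · exact Or.inr ⟨ms, rfl, hm⟩
      · obtain ⟨rfl, htail⟩ : BlockLetter.sep = c ∧ blockWord ms = as ++ .sep :: r := by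
          simpa using has
        rcases List.mem_cons.1 hm with rfl | hm
        · simp
        · refine (ih htail hm).imp_left fun h => ?_
          simp only [List.length_append, List.length_cons]
          omega
    · rcases bs with _ | ⟨c, bs⟩
      · obtain rfl : r = blockWord ms := by simpa using hr
        rw [List.append_nil] at hbs
        rcases List.mem_cons.1 hm with rfl | hm
        · simp [← hbs]
        · exact Or.inr ⟨ms, rfl, hm⟩
      · obtain rfl : BlockLetter.sep = c := by
          simp at hr
          exact hr.1
        have : BlockLetter.sep ∈ List.replicate m₀ BlockLetter.a := by simp [hbs]
        simp at this

/-- Every copy of `v` contains a separator, so no block extends over more than two adjacent copies,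
and the bound is independent of `i`. The induction cuts at the separator of the first copy; what
remains of that copy is the next `u`. -/
theorem le_of_blockWord_eq_of_sep_mem {v x : List BlockLetter} (hv : BlockLetter.sep ∈ v) {K : ℕ}
    (hK : 2 * v.length + x.length ≤ K) (i : ℕ) {ms : List ℕ} {u : List BlockLetter}
    (hu : u.length + v.length + x.length ≤ K)
    (h : blockWord ms = u ++ ((List.replicate i v).flatten ++ x)) {m : ℕ} (hm : m ∈ ms) :
    m ≤ K := by
  induction i generalizing u ms with
  | zero =>
    have := length_le_of_mem_blockWord hm
    rw [h] at this
    simp at this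
    omega
  | succ i ih =>
    obtain ⟨v₁, v₂, hv⟩ := List.append_of_mem hv
    have hlen := congrArg List.length hv
    simp only [List.length_append, List.length_cons] at hlen
    have h' : blockWord ms
        = (u ++ v₁) ++ .sep :: (v₂ ++ ((List.replicate i v).flatten ++ x)) := by
      rw [h, List.replicate_succ, List.flatten_cons]
      nth_rw 1 [hv]
      simp
    rcases le_length_or_mem_of_blockWord_eq_append_sep h' hm with h₁ | ⟨ms', h₁, h₂⟩
    · rw [List.length_append] at h₁
      omega
    · exact ih (by omega) h₁ h₂

/-- Among two different blocks, at most one is much affected by a factor without separator. -/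
theorem le_or_le_of_blockWord_eq {ms : List ℕ} {t : ℕ} {l r : List BlockLetter}
    (h : blockWord ms = l ++ (List.replicate t .a ++ r)) {m m' : ℕ} (hm : m ∈ ms) (hm' : m' ∈ ms)
    (hne : m ≠ m') : m ≤ l.length + r.length ∨ m' ≤ l.length + r.length := by
  induction ms generalizing l with
  | nil => simp at hm
  | cons m₀ ms ih =>
    -- Since `m ≠ m'`, one of them is a block of `ms`, hence is short once `blockWord ms` fits into
    -- `r`.
    have tail : (blockWord ms).length ≤ r.length →
        m ≤ l.length + r.length ∨ m' ≤ l.length + r.length := by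
      intro hle
      rcases List.mem_cons.1 hm with rfl | hm
      · have := length_le_of_mem_blockWord ((List.mem_cons.1 hm').resolve_left hne.symm)
        omega
      · have := length_le_of_mem_blockWord hm
        omega
    -- The separator after block `m₀` cannot lie among the `a`s, so it already belongs to `r`.
    have short : ∀ cs : List BlockLetter, .sep :: blockWord ms = cs ++ r →
        (∀ c ∈ cs, c = BlockLetter.a) → (blockWord ms).length ≤ r.length := by
      rintro (_ | ⟨c, cs⟩) hcs hc
      · rw [← List.nil_append r, ← hcs]
        simp
      · have h₁ := hc c (by simp)
        simp [h₁] at hcs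
    rw [blockWord_cons] at h
    rcases List.append_eq_append_iff.1 h with ⟨as, rfl, has⟩ | ⟨bs, hbs, hr⟩
    · rcases as with _ | ⟨c, as⟩
      · exact tail (short _ has fun c hc => List.eq_of_mem_replicate hc)
      · obtain ⟨rfl, htail⟩ :
            BlockLetter.sep = c ∧ blockWord ms = as ++ (List.replicate t .a ++ r) := by
          simpa using has
        simp only [List.length_append, List.length_replicate, List.length_cons]
        rcases List.mem_cons.1 hm with rfl | hm
        · omega
        rcases List.mem_cons.1 hm' with rfl | hm'
        · omega
        have := ih htail hm hm'
        omega
    · rcases List.append_eq_append_iff.1 hr with ⟨cs, rfl, rfl⟩ | ⟨cs, hcs, hs⟩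
      · refine tail ?_
        simp only [List.length_append, List.length_cons]
        omega
      · exact tail (short cs hs fun c hc => List.eq_of_mem_replicate (n := t)
          (hcs ▸ List.mem_append_right _ hc))

/-! ### Tagged words of the two-phase language -/

/-- The letters other than `b` of a tagged word, without their tags. -/
def skeleton (w : List (BlockLetter × Bool)) : List BlockLetter :=
  (w.map Prod.fst).filter (· ≠ .b)

theorem skeleton_append (v w : List (BlockLetter × Bool)) :
    skeleton (v ++ w) = skeleton v ++ skeleton w := by
  simp [skeleton]

theorem skeleton_flatten_replicate (i : ℕ) (v : List (BlockLetter × Bool)) :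
    skeleton (List.replicate i v).flatten = (List.replicate i (skeleton v)).flatten := by
  induction i with
  | zero => rfl
  | succ i ih => simp [List.replicate_succ, skeleton_append, ih]

theorem skeleton_eq_nil {v : List (BlockLetter × Bool)} (h : ∀ p ∈ v, p.1 = BlockLetter.b) :
    skeleton v = [] := by
  simpa [skeleton, or_imp, forall_and] using h

theorem count_flatten_replicate {α : Type*} [BEq α] (c : α) (i : ℕ) (v : List α) :
    (List.replicate i v).flatten.count c = i * v.count c := by
  induction i with
  | zero => simp
  | succ i ih => simp [List.replicate_succ, ih, Nat.add_mul, add_comm]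

/-- The order of the letters in a word of the two-phase language of `blockLanguage`: after the first
`b` there are only letters `b`, and the tag `true` comes after the tag `false`. -/
def Precedes (p q : BlockLetter × Bool) : Prop :=
  (p = (.b, false) → q.1 = .b) ∧ (p = (.b, true) → q = (.b, true))

theorem pairwise_of_mem_blockLanguage {w : List BlockLetter} (h : w ∈ blockLanguage) :
    w.Pairwise fun x y => x = .b → y = .b := by
  obtain ⟨ms, n, -, rfl⟩ := mem_blockLanguage.1 h
  refine List.pairwise_append.2 ⟨?_, ?_, ?_⟩
  · refine List.pairwise_of_forall_mem_list fun x hx y _ hb => ?_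
    exact absurd (hb ▸ hx) (b_notMem_blockWord ms)
  · exact List.pairwise_of_forall_mem_list fun x _ y hy _ => List.eq_of_mem_replicate hy
  · exact fun x _ y hy _ => List.eq_of_mem_replicate hy

/-- A `b` in `v` prevents `v'` from opening new blocks. Erasing the `b`s then shows that both words
have the same list of blocks. -/
theorem twoPhase_blockLanguage {v v' : List BlockLetter} (hv : v ∈ blockLanguage)
    (hvv' : v ++ v' ∈ blockLanguage) (hb : BlockLetter.b ∈ v) :
    ∃ ms n m, n ∈ ms ∧ n + m ∈ ms ∧ v = blockWord ms ++ List.replicate n .b ∧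
      v' = List.replicate m .b := by
  have hv' : ∀ c ∈ v', c = BlockLetter.b := fun c hc =>
    (List.pairwise_append.1 (pairwise_of_mem_blockLanguage hvv')).2.2 _ hb c hc rfl
  obtain ⟨m, rfl⟩ : ∃ m, v' = List.replicate m .b := ⟨_, List.eq_replicate_of_mem hv'⟩
  obtain ⟨ms, n, hn, rfl⟩ := mem_blockLanguage.1 hv
  obtain ⟨ms', n', hn', h⟩ := mem_blockLanguage.1 hvv'
  have hf : ∀ ms, (blockWord ms).filter (· ≠ .b) = blockWord ms := fun ms =>
    List.filter_eq_self.2 fun c hc => by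
      simpa using fun h : c = .b => b_notMem_blockWord ms (h ▸ hc)
  have h₁ := congrArg (List.filter (· ≠ .b)) h
  rw [List.filter_append, List.filter_append, List.filter_append, hf, hf] at h₁
  simp only [List.filter_replicate, ne_eq, not_true_eq_false, decide_false, Bool.false_eq_true,
    if_false, List.append_nil] at h₁
  obtain rfl := blockWord_injective h₁
  have h₂ := congrArg List.length h
  simp only [List.length_append, List.length_replicate] at h₂
  obtain rfl : n + m = n' := by omega
  exact ⟨ms, n, m, hn, hn', rfl, rfl⟩

/-! ### The block language is not explorable -/

namespace PDA

theorem twoPhase_spec {P : PDA BlockLetter} (hP : P.language = blockLanguage)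
    {w : List (BlockLetter × Bool)} (hw : w ∈ P.twoPhase.language)
    (hb : 0 < w.count (.b, false)) : w.Pairwise Precedes ∧ ∃ ms, skeleton w = blockWord ms ∧
      w.count (.b, false) ∈ ms ∧ w.count (.b, false) + w.count (.b, true) ∈ ms := by
  obtain ⟨v, v', rfl, hv, hvv'⟩ := P.exists_of_mem_twoPhase_language hw
  rw [hP] at hv hvv'
  have hbv : BlockLetter.b ∈ v := by
    have := List.count_pos_iff.1 hb
    simpa using this
  obtain ⟨ms, n, m, hn, hm, rfl, rfl⟩ := twoPhase_blockLanguage hv hvv' hbv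
  have htag : Function.Injective fun c : BlockLetter => (c, false) := fun c d h => by simpa using h
  have h₀ : (blockWord ms).count .b = 0 := List.count_eq_zero.2 (b_notMem_blockWord ms)
  have hf : (blockWord ms).filter (· ≠ .b) = blockWord ms := List.filter_eq_self.2 fun c hc => by
    simpa using fun h : c = .b => b_notMem_blockWord ms (h ▸ hc)
  have h₁ : ((blockWord ms).map (·, false)).count (.b, true) = 0 :=
    List.count_eq_zero.2 (by simp)
  have h₂ : ((blockWord ms).map (·, false)).count (.b, false) = 0 := by
    rw [List.count_map_of_injective _ _ htag, h₀]
  refine ⟨List.pairwise_append.2 ⟨?_, ?_, ?_⟩, ms, ?_, ?_, ?_⟩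
  · refine List.pairwise_map.2 ((pairwise_of_mem_blockLanguage hv).imp fun {c d} h => ⟨?_, ?_⟩)
    · simpa using h
    · simp
  · exact List.pairwise_of_forall_mem_list fun p _ q hq => by
      simp only [List.map_replicate] at hq
      simp [Precedes, List.eq_of_mem_replicate hq]
  · intro p hp q hq
    simp only [List.map_replicate] at hq
    simp [Precedes, List.eq_of_mem_replicate hq]
  · simp only [skeleton, List.map_append, List.map_map, List.filter_append, Function.comp_def,
      List.map_id', hf]
    simp
  · simpa [h₂, List.count_replicate] using hn
  · simpa [h₁, h₂, List.count_replicate] using hm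

theorem not_pumping {P : PDA BlockLetter} (hP : P.language = blockLanguage)
    {u v x y z : List (BlockLetter × Bool)}
    (htrue : 0 < (u ++ (v ++ (x ++ (y ++ z)))).count (.b, true))
    (hfalse : 0 < v.count (.b, false) + y.count (.b, false))
    (h : ∀ i : ℕ, u ++ ((List.replicate i v).flatten ++ (x ++ ((List.replicate i y).flatten ++ z)))
      ∈ P.twoPhase.language) : False := by
  have spec : ∀ i : ℕ, 0 < i → _ := fun i hi => twoPhase_spec hP (h i) (by
    simp only [List.count_append, count_flatten_replicate]
    have : i * 1 ≤ i * (v.count (.b, false) + y.count (.b, false)) :=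
      Nat.mul_le_mul le_rfl hfalse
    rw [Nat.mul_add] at this
    omega)
  -- With exponent 2, order constraints hold between any two letters of `v`, and likewise of `y`, in
  -- both directions.
  have hpw := (spec 2 two_pos).1
  simp only [List.replicate_succ, List.replicate_zero, List.flatten_cons, List.flatten_nil,
    List.append_nil, List.append_assoc, List.pairwise_append, List.mem_append] at hpw
  have hvv : ∀ p ∈ v, ∀ q ∈ v, Precedes p q := fun p hp q hq => by grind
  have hvy : ∀ p ∈ v, ∀ q ∈ y, Precedes p q := fun p hp q hq => by grind
  have hyy : ∀ p ∈ y, ∀ q ∈ y, Precedes p q := fun p hp q hq => by grind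
  clear hpw
  have hy : ∀ p ∈ y, p.1 = BlockLetter.b := by
    rcases Nat.eq_zero_or_pos (v.count (.b, false)) with hv | hv
    · rw [hv, zero_add, List.count_pos_iff] at hfalse
      exact fun p hp => (hyy _ hfalse p hp).1 rfl
    · exact fun p hp => (hvy _ (List.count_pos_iff.1 hv) p hp).1 rfl
  rcases Nat.eq_zero_or_pos (v.count (.b, false)) with hv | hv
  -- Here `y` pumps first-phase `b`s and no second-phase `b` is pumped, so the gap between the two
  -- block lengths stays positive; only `v` can alter the blocks.
  · rw [hv, zero_add] at hfalse
    have hby := List.count_pos_iff.1 hfalse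
    have hv' : v.count (.b, true) = 0 :=
      List.count_eq_zero.2 fun hp => by simpa using (hvy _ hp _ hby).2 rfl
    have hy' : y.count (.b, true) = 0 :=
      List.count_eq_zero.2 fun hp => by simpa using (hyy _ hp _ hby).2 rfl
    set K := (skeleton u).length + 2 * (skeleton v).length + (skeleton x ++ skeleton z).length
    -- Exponent `K + 1` makes both required block lengths exceed `K`, which bounds every block if
    -- `v` has a separator, and otherwise one of any two different blocks.
    obtain ⟨-, ms, hms, hn, hm⟩ := spec (K + 1) K.succ_pos
    simp only [skeleton_append, skeleton_flatten_replicate, skeleton_eq_nil hy,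
      List.flatten_replicate_nil, List.nil_append] at hms
    simp only [List.count_append, count_flatten_replicate, hv, hv', hy'] at hn hm htrue
    have hge : K + 1 ≤ (K + 1) * y.count (.b, false) := Nat.le_mul_of_pos_right _ hfalse
    by_cases hsep : BlockLetter.sep ∈ skeleton v
    · have := le_of_blockWord_eq_of_sep_mem hsep (K := K) (by omega) (K + 1) (by omega) hms.symm hn
      omega
    · have hrep : skeleton v = List.replicate (skeleton v).length .a := by
        refine List.eq_replicate_of_mem fun c hc => ?_
        cases c with
        | a => rfl
        | sep => exact absurd hc hsep
        | b => simp [skeleton] at hc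
      rw [hrep, List.flatten_replicate_replicate] at hms
      have := le_or_le_of_blockWord_eq hms.symm hn hm (by omega)
      omega
  -- Here `v` and `y` consist of `b`s only: the blocks stay fixed while the number of first-phase
  -- `b`s grows.
  · have hbv := List.count_pos_iff.1 hv
    have hv' : ∀ p ∈ v, p.1 = BlockLetter.b := fun p hp => (hvv _ hbv p hp).1 rfl
    set K := (skeleton u ++ (skeleton x ++ skeleton z)).length
    obtain ⟨-, ms, hms, hn, -⟩ := spec (K + 1) K.succ_pos
    simp only [skeleton_append, skeleton_flatten_replicate, skeleton_eq_nil hy,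
      skeleton_eq_nil hv', List.flatten_replicate_nil, List.nil_append] at hms
    have hle := length_le_of_mem_blockWord hn
    rw [← hms] at hle
    simp only [List.count_append, count_flatten_replicate] at hle
    have hge : K + 1 ≤ (K + 1) * v.count (.b, false) := Nat.le_mul_of_pos_right _ hv
    omega

theorem not_isExplorable_of_language_eq_blockLanguage {P : PDA BlockLetter}
    (hP : P.language = blockLanguage) (k : ℕ) : ¬ P.IsExplorable k := by
  rintro ⟨σ, hσ⟩
  obtain ⟨p, hp⟩ := P.twoPhase.exists_pumping (.b, false)
  -- There are `k + 1` different block lengths, one more than tokens, each at least the pumping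
  -- constant.
  set U := blockWord ((List.range (k + 1)).map (p + ·))
  have hmem : ∀ j : Fin (k + 1), U ++ List.replicate (p + j) .b ∈ P.language := fun j => by
    rw [hP]
    refine mem_blockLanguage.2 ⟨_, p + j, ?_, rfl⟩
    exact List.mem_map.2 ⟨j, List.mem_range.2 j.2, rfl⟩
  choose l hl using fun j => hσ _ (hmem j)
  obtain ⟨i, j, hij, hlij⟩ : ∃ i j, i < j ∧ l i = l j := by
    obtain ⟨i, j, hne, heq⟩ := Fintype.exists_ne_map_eq_of_card_lt l (by simp)
    rcases lt_or_gt_of_ne hne with h | h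
    · exact ⟨i, j, h, heq⟩
    · exact ⟨j, i, h, heq.symm⟩
  have hsplit : U ++ List.replicate (p + j) .b
      = (U ++ List.replicate (p + i) .b) ++ List.replicate (j - i : ℕ) .b := by
    rw [List.append_assoc, ← List.replicate_add]
    congr 2
    omega
  have : Nonempty BlockLetter := ⟨.a⟩
  have hj := hl j
  rw [← hlij, hsplit] at hj
  have hrun := σ.conf_run [] (U ++ List.replicate (p + i) .b) (l i)
  rw [σ.conf_nil, List.nil_append] at hrun
  have hw := P.twoPhase_mem hrun (hl i) (σ.conf_ne_nil _ _) (σ.conf_run _ _ _) hj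
  obtain ⟨u, v, x, y, z, hsplit', hpos, hpump⟩ := hp _ hw (by
    simp [List.count_replicate]
    omega)
  refine not_pumping hP ?_ hpos hpump
  rw [← hsplit']
  have : (i : ℕ) < j := hij
  simp [List.count_replicate]
  omega

end PDA

theorem explCFL_subset_CFL (α : Type*) [Finite α] : ExplCFL α ⊆ CFL α := by
  intro L hL
  obtain ⟨k, P, -, rfl⟩ := Set.mem_iUnion.1 hL
  exact P.isContextFree_language

theorem mainTheorem2 :
    (∀ (α : Type*) [Finite α], ExplCFL α ⊆ CFL α) ∧
    ExplCFL BlockLetter ⊂ CFL BlockLetter ∧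
    blockLanguage ∈ CFL BlockLetter ∧
    ∀ k : ℕ, blockLanguage ∉ ExplCFLWith BlockLetter k := by
  have hnot : ∀ k : ℕ, blockLanguage ∉ ExplCFLWith BlockLetter k := by
    rintro k ⟨P, hk, hP⟩
    exact P.not_isExplorable_of_language_eq_blockLanguage hP k hk
  have hblock : blockLanguage ∈ CFL BlockLetter := isContextFree_blockLanguage
  refine ⟨fun α _ => explCFL_subset_CFL α, ⟨explCFL_subset_CFL _, fun h => ?_⟩, hblock, hnot⟩
  obtain ⟨k, hk⟩ := Set.mem_iUnion.1 (h hblock)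
  exact hnot k hk
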